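/- For a rational function $R=p/q$ over $\mathbb{C}$ in lowest terms put $\deg R=\max(\deg p,\deg q)$ and consider $f(z)=R(z)-\overline{z}$. A zero of $f$ is a point $\zeta$, not a pole of $R$, with $f(\zeta)=0$; it is called sense-preserving if $|R'(\zeta)|>1$, sense-reversing if $|R'(\zeta)|<1$, and regular if $|R'(\zeta)|\neq 1$. The function $f$ is regular if all its zeros are regular. If $g$ is continuous and nonzero in a punctured neighbourhood of $\zeta$, and $g$ is zero, discontinuous or undefined at $\zeta$, then the Poincar\'e index $\operatorname{ind}(\zeta;g)\in\mathbb{Z}$ is $\frac{1}{2\pi}$ times the change of a continuous branch of $\arg g$ along a small positively oriented circle around $\zeta$. Let $D(a,r)$ and $\overline{D}(a,r)$ denote the open and the closed disk, and $A(a,r,s)=\{z: r<|z-a|<s\}$. **Theorem.** Let $f(z)=R(z)-\overline{z}$ with $\deg R\ge 2$ satisfy $\lim_{z\to\infty}f(z)=\infty$. Let $z_0\in\mathbb{C}$ and the integer $n\ge 3$ satisfy $$f(z_0)=0,\qquad R'(z_0)=\dots=R^{(n-2)}(z_0)=0,\qquad R^{(n-1)}(z_0)\ne 0,$$ and put $\eta=\left(\frac{n}{n-1}\right)^{1/2}$.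 Then there are $r>0$ and $\varepsilon_0>0$ such that for all $0<\varepsilon<\varepsilon_0$ the disk $\overline{D}(z_0,\eta\sqrt{\varepsilon})$ contains no zero of $f$ other than $z_0$, and the function $$F(z)=f(z)+\frac{\varepsilon}{z-z_0}=\Big(R(z)+\frac{\varepsilon}{z-z_0}\Big)-\overline{z}$$ satisfies the following (for $F$, the notions above refer to the rational function $R(z)+\frac{\varepsilon}{z-z_0}$). (i) $F$ has at least $n$ zeros in $A(z_0,\eta^{-1}\sqrt{\varepsilon},\sqrt{\varepsilon})$, at least $n$ zeros in $A(z_0,\sqrt{\varepsilon},\eta\sqrt{\varepsilon})$, and no zeros in $\overline{D}(z_0,\eta^{-1}\sqrt{\varepsilon})$. If $F$ is regular, then at least $n$ of its zeros in $A(z_0,\eta^{-1}\sqrt{\varepsilon},\sqrt{\varepsilon})$ are sense-preserving and at least $n$ of its zeros in $A(z_0,\sqrt{\varepsilon},\eta\sqrt{\varepsilon})$ are sense-reversing. (ii) Let $z_1,\dots,z_N$ be the distinct regular zeros of $f$ outside $\overline{D}(z_0,\eta\sqrt{\varepsilon})$. The disks $\overline{D}(z_k,r)$ are mutually disjoint,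 $F$ has exactly one zero $z_k'$ in each $D(z_k,r)$, and $\operatorname{ind}(z_k';F)=\operatorname{ind}(z_k;f)$. (iii) If $f$ is regular, then $f$ and $F$ have the same finite number of zeros outside $\overline{D}(z_0,\eta\sqrt{\varepsilon})$. -/

import Mathlib

open scoped ComplexConjugate

namespace RationalHarmonic

/-- The degree of a rational function `R = p / q` in lowest terms: `max (deg p) (deg q)`. -/
noncomputable def ratDegree (R : RatFunc ℂ) : ℕ :=
  max R.num.natDegree R.denom.natDegree

/-- The value `R(z)`. At a pole of `R` this is a meaningless default value, so everything
below that depends on a value of `R` at a point is guarded by `¬ IsPole R z`. -/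
noncomputable def ratVal (R : RatFunc ℂ) (z : ℂ) : ℂ :=
  RatFunc.eval (RingHom.id ℂ) z R

/-- `z` is a pole of `R` (a root of the denominator in lowest terms). -/
def IsPole (R : RatFunc ℂ) (z : ℂ) : Prop :=
  R.denom.eval z = 0

/-- The rational harmonic function `z ↦ R(z) - conj z`. -/
noncomputable def harm (R : RatFunc ℂ) (z : ℂ) : ℂ :=
  ratVal R z - conj z

/-- `z` is a zero of `R(z) - conj z`; a pole of `R` is never a zero. -/
def IsZero (R : RatFunc ℂ) (z : ℂ) : Prop :=
  ¬ IsPole R z ∧ harm R z = 0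

/-- A sense-preserving zero of `R(z) - conj z`: a zero with `|R'(z)| > 1`. -/
def IsSensePreservingZero (R : RatFunc ℂ) (z : ℂ) : Prop :=
  IsZero R z ∧ 1 < ‖deriv (ratVal R) z‖

/-- A sense-reversing zero of `R(z) - conj z`: a zero with `|R'(z)| < 1`. -/
def IsSenseReversingZero (R : RatFunc ℂ) (z : ℂ) : Prop :=
  IsZero R z ∧ ‖deriv (ratVal R) z‖ < 1

/-- A regular zero of `R(z) - conj z`: a zero that is not singular, i.e. `|R'(z)| ≠ 1`. -/
def IsRegularZero (R : RatFunc ℂ) (z : ℂ) : Prop :=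
  IsZero R z ∧ ‖deriv (ratVal R) z‖ ≠ 1

/-- `R(z) - conj z` is regular: all its zeros are regular. -/
def IsRegular (R : RatFunc ℂ) : Prop :=
  ∀ z : ℂ, IsZero R z → IsRegularZero R z

/-- The perturbed rational function `R(z) + ε / (z - z₀)`, so that
`harm (perturb R z₀ ε)` is `F(z) = R(z) - conj z + ε / (z - z₀)`. -/
noncomputable def perturb (R : RatFunc ℂ) (z₀ : ℂ) (ε : ℝ) : RatFunc ℂ :=
  R + RatFunc.C (ε : ℂ) / (RatFunc.X - RatFunc.C z₀)

/-- `v` is the winding of `f` along the curve `γ : [a, b] → ℂ`: `f` is continuous and nonzero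
along the curve, `Θ` is a continuous branch of the argument of `f` along the curve, and
`v = (Θ b - Θ a) / (2 π)`. -/
def HasWinding (f : ℂ → ℂ) (γ : ℝ → ℂ) (a b : ℝ) (v : ℝ) : Prop :=
  ContinuousOn (fun t => f (γ t)) (Set.Icc a b) ∧
  (∀ t ∈ Set.Icc a b, f (γ t) ≠ 0) ∧
  ∃ Θ : ℝ → ℝ, ContinuousOn Θ (Set.Icc a b) ∧
    (∀ t ∈ Set.Icc a b, f (γ t) = (‖f (γ t)‖ : ℂ) * Complex.exp ((Θ t : ℂ) * Complex.I)) ∧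
    v = (Θ b - Θ a) / (2 * Real.pi)

/-- `z₀` is an isolated exceptional point of `f` and its Poincaré index is the integer `m`:
`f` is continuous and nonzero in a punctured disk around `z₀`, it vanishes or is not continuous
at `z₀`, and `m` is the winding of `f` along every positively oriented circle around `z₀` inside
that disk. (The winding is the same for all Jordan curves around `z₀` in the punctured disk, so
circles suffice.) -/
def HasPoincareIndex (f : ℂ → ℂ) (z₀ : ℂ) (m : ℤ) : Prop :=
  (f z₀ = 0 ∨ ¬ ContinuousAt f z₀) ∧
  ∃ ρ : ℝ, 0 < ρ ∧
    ContinuousOn f (Metric.ball z₀ ρ \ {z₀}) ∧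
    (∀ z ∈ Metric.ball z₀ ρ \ {z₀}, f z ≠ 0) ∧
    ∀ s : ℝ, 0 < s → s < ρ → HasWinding f (circleMap z₀ s) 0 (2 * Real.pi) (m : ℝ)

/-- The open annulus `A(z₀, r, s)`. -/
def annulus (z₀ : ℂ) (r s : ℝ) : Set ℂ :=
  {z | r < dist z z₀ ∧ dist z z₀ < s}

end RationalHarmonic

/-!
Write `w = z - z₀` and `h(z) = w (R(z) - conj z₀)`. Multiplying by `w` turns the equation
`F(z) = 0` into `h(z) = |w|² - ε`, whose right side is real. The holomorphic function `h` vanishes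
to order exactly `n ≥ 3` at `z₀`, so it is small compared with `|w|²`, which confines the zeros of
`F` in a fixed disk around `z₀` to the annulus `η⁻¹ √ε < |w| < η √ε`
(`zero_near_center`). Moreover `h` is the `n`-th power of a local coordinate
(`exists_root_coordinate`), so it is real on `2 n` curves issuing from `z₀`, positive on half of
them and negative on the others; each curve carries a zero of `F` by the intermediate value theorem
(`eventually_le_encard_zeros`), outside the circle `|w| = √ε` in the first case and inside it in the
second. The identity `w² F' = (n - 1 + o(1)) h - ε`, where `F'` is the derivative of the rational
part of `F`, shows that these zeros reverse, respectively preserve, the sense.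

Away from `z₀` the function `F` is a small perturbation of `f`. Since `deg R ≥ 2`, `f` has only
finitely many zeros (`finite_setOf_isZero`), so one radius `r` serves for all regular ones.
Around a regular zero `a`, both `f` and `F` are Lipschitz-close to the invertible real linear map
`w ↦ R'(a) w - conj w`, so `F` has exactly one zero near `a` by the quantitative inverse function
theorem (`eventually_zero_near_regular`). The index at a regular zero is the sign of
`|R'|² - 1` (`hasPoincareIndex_of_regular`), which does not change under the perturbation. Finally
`|f|` has a positive lower bound off any neighbourhood of its zeros (`exists_lower_bound`), so if
`f` is regular then `F` has no further zeros.
-/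

namespace RationalHarmonic

open Filter Topology Metric

/-! ### Poles and values of rational functions -/

theorem not_isPole_of_denom_dvd {R : RatFunc ℂ} {z : ℂ} {d : Polynomial ℂ} (h : R.denom ∣ d)
    (hd : d.eval z ≠ 0) : ¬ IsPole R z := fun hp =>
  hd (Polynomial.eval_eq_zero_of_dvd_of_eval_eq_zero h hp)

theorem not_isPole_add {R S : RatFunc ℂ} {z : ℂ} (hR : ¬ IsPole R z) (hS : ¬ IsPole S z) :
    ¬ IsPole (R + S) z :=
  not_isPole_of_denom_dvd (RatFunc.denom_add_dvd R S) (by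
    rw [Polynomial.eval_mul]; exact mul_ne_zero hR hS)

theorem not_isPole_mul {R S : RatFunc ℂ} {z : ℂ} (hR : ¬ IsPole R z) (hS : ¬ IsPole S z) :
    ¬ IsPole (R * S) z :=
  not_isPole_of_denom_dvd (RatFunc.denom_mul_dvd R S) (by
    rw [Polynomial.eval_mul]; exact mul_ne_zero hR hS)

theorem not_isPole_C (c z : ℂ) : ¬ IsPole (RatFunc.C c) z := by
  simp [IsPole]

theorem not_isPole_X (z : ℂ) : ¬ IsPole RatFunc.X z := by
  simp [IsPole]

theorem ratVal_C (c z : ℂ) : ratVal (RatFunc.C c) z = c := by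
  simp [ratVal]

theorem ratVal_X (z : ℂ) : ratVal RatFunc.X z = z := by
  simp [ratVal]

theorem ratVal_add {R S : RatFunc ℂ} {z : ℂ} (hR : ¬ IsPole R z) (hS : ¬ IsPole S z) :
    ratVal (R + S) z = ratVal R z + ratVal S z :=
  RatFunc.eval_add _ _ hR hS

theorem ratVal_mul {R S : RatFunc ℂ} {z : ℂ} (hR : ¬ IsPole R z) (hS : ¬ IsPole S z) :
    ratVal (R * S) z = ratVal R z * ratVal S z :=
  RatFunc.eval_mul _ _ hR hS

theorem ratVal_eq_div (R : RatFunc ℂ) (z : ℂ) :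
    ratVal R z = R.num.eval z / R.denom.eval z := rfl

theorem analyticAt_ratVal {R : RatFunc ℂ} {z : ℂ} (h : ¬ IsPole R z) :
    AnalyticAt ℂ (ratVal R) z := by
  have : ratVal R = fun z => R.num.eval z / R.denom.eval z := rfl
  rw [this]
  exact (AnalyticOnNhd.eval_polynomial R.num z (Set.mem_univ z)).div
    (AnalyticOnNhd.eval_polynomial R.denom z (Set.mem_univ z)) h

theorem finite_setOf_isPole (R : RatFunc ℂ) : {z | IsPole R z}.Finite := by
  refine (R.denom.roots.toFinset.finite_toSet).subset fun z hz => ?_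
  simp only [Finset.mem_coe, Multiset.mem_toFinset]
  exact (Polynomial.mem_roots (RatFunc.denom_ne_zero R)).2 hz

theorem isOpen_setOf_not_isPole (R : RatFunc ℂ) : IsOpen {z | ¬ IsPole R z} :=
  (finite_setOf_isPole R).isClosed.isOpen_compl

/-! ### Finiteness of the zero set -/

/-- A polynomial in `R` can be evaluated at every point that is not a pole of `R`. -/
theorem ratVal_aeval {R : RatFunc ℂ} {z : ℂ} (hR : ¬ IsPole R z) (g : Polynomial ℂ) :
    ¬ IsPole (Polynomial.aeval R g) z ∧
      ratVal (Polynomial.aeval R g) z = g.eval (ratVal R z) := by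
  induction g using Polynomial.induction_on with
  | C a =>
    simp only [Polynomial.aeval_C, RatFunc.algebraMap_eq_C, Polynomial.eval_C]
    exact ⟨not_isPole_C a z, ratVal_C a z⟩
  | add p q hp hq =>
    rw [map_add, Polynomial.eval_add]
    exact ⟨not_isPole_add hp.1 hq.1, by rw [ratVal_add hp.1 hq.1, hp.2, hq.2]⟩
  | monomial n a h =>
    have : Polynomial.aeval R (Polynomial.C a * Polynomial.X ^ (n + 1)) =
        Polynomial.aeval R (Polynomial.C a * Polynomial.X ^ n) * R := by
      simp [pow_succ, mul_assoc]
    rw [this]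
    refine ⟨not_isPole_mul h.1 hR, ?_⟩
    rw [ratVal_mul h.1 hR, h.2]
    simp [pow_succ, mul_assoc]

theorem eval_map_conj (g : Polynomial ℂ) (z : ℂ) :
    (g.map (starRingEnd ℂ)).eval (conj z) = conj (g.eval z) := by
  rw [Polynomial.eval_map, Polynomial.eval₂_at_apply]

/-- Conjugating `conj z = R(z)` shows that every zero `z` of `R(z) - conj z` is a fixed point of
the rational function `conj R ∘ R`. This composition has degree `(deg R) ^ 2 > 1`: otherwise `X`
would lie in the field `ℂ(R)`, over which `ℂ(X)` has degree `deg R`. So the fixed points are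
finite in number. -/
theorem finite_setOf_isZero {R : RatFunc ℂ} (hdeg : 2 ≤ ratDegree R) :
    {z | IsZero R z}.Finite := by
  classical
  -- `p'` and `q'` are the numerator and denominator of `conj R`, and the zeros of `S` contain the
  -- fixed points of `conj R ∘ R`
  set p' := R.num.map (starRingEnd ℂ) with hp'
  set q' := R.denom.map (starRingEnd ℂ) with hq'
  set S : RatFunc ℂ := Polynomial.aeval R p' +
    (RatFunc.C (-1) * RatFunc.X) * Polynomial.aeval R q' with hS
  have hzero : ∀ z, IsZero R z → S.num.eval z = 0 := by
    intro z hz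
    obtain ⟨hpole, hz⟩ := hz
    have h1 := ratVal_aeval hpole p'
    have h2 := ratVal_aeval hpole q'
    have h3 : ¬ IsPole (RatFunc.C (-1) * RatFunc.X) z :=
      not_isPole_mul (not_isPole_C _ _) (not_isPole_X _)
    have h4 := not_isPole_mul h3 h2.1
    have hval : ratVal R z = conj z := sub_eq_zero.1 hz
    have h5 : ratVal S z = 0 := by
      rw [hS, ratVal_add h1.1 h4, ratVal_mul h3 h2.1,
        ratVal_mul (not_isPole_C _ _) (not_isPole_X _), ratVal_C, ratVal_X, h1.2, h2.2, hval,
        hp', hq', eval_map_conj, eval_map_conj]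
      have hne : R.denom.eval z ≠ 0 := hpole
      have h6 : R.num.eval z = conj z * R.denom.eval z := by
        rw [ratVal_eq_div] at hval
        field_simp at hval
        rw [hval, mul_comm]
      rw [h6]; simp
    rw [ratVal_eq_div, div_eq_zero_iff] at h5
    exact h5.resolve_right (not_isPole_add h1.1 h4)
  by_contra hinf
  have hS0 : S = 0 := by
    rw [← RatFunc.num_eq_zero_iff]
    by_contra hne
    refine hinf ((S.num.roots.toFinset.finite_toSet).subset fun z hz => ?_)
    simp only [Finset.mem_coe, Multiset.mem_toFinset]
    exact (Polynomial.mem_roots hne).2 (hzero z hz)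
  have hnc : ¬ ∃ c, R = RatFunc.C c := by
    rintro ⟨c, rfl⟩
    simp [ratDegree] at hdeg
  have htr : Transcendental ℂ R := RatFunc.transcendental_of_ne_C R hnc
  have hq0 : Polynomial.aeval R q' ≠ 0 := by
    intro h
    have : q' = 0 := (transcendental_iff.1 htr) q' h
    rw [hq', Polynomial.map_eq_zero] at this
    exact RatFunc.denom_ne_zero R this
  have hX : (RatFunc.X : RatFunc ℂ) = Polynomial.aeval R p' / Polynomial.aeval R q' := by
    rw [eq_div_iff hq0]
    have : Polynomial.aeval R p' - RatFunc.X * Polynomial.aeval R q' = 0 := by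
      rw [← hS0, hS]; simp [sub_eq_add_neg]
    exact (sub_eq_zero.1 this).symm
  have hmem : ∀ g : Polynomial ℂ,
      Polynomial.aeval R g ∈ IntermediateField.adjoin ℂ {R} := fun g =>
    IntermediateField.algebra_adjoin_le_adjoin ℂ {R}
      (Polynomial.aeval_mem_adjoin_singleton ℂ R)
  have htop : IntermediateField.adjoin ℂ {R} = ⊤ := by
    rw [eq_top_iff, ← RatFunc.adjoin_X, IntermediateField.adjoin_simple_le_iff, hX]
    exact div_mem (hmem _) (hmem _)
  have hfin := RatFunc.finrank_eq_max_natDegree R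
  rw [htop, IntermediateField.finrank_top] at hfin
  unfold ratDegree at hdeg
  omega

/-! ### The perturbed function -/

theorem X_sub_C_eq_algebraMap (a : ℂ) : (RatFunc.X - RatFunc.C a : RatFunc ℂ) =
    algebraMap (Polynomial ℂ) (RatFunc ℂ) (Polynomial.X - Polynomial.C a) := by simp

theorem X_sub_C_ne_zero (a : ℂ) : (RatFunc.X - RatFunc.C a : RatFunc ℂ) ≠ 0 := by
  rw [X_sub_C_eq_algebraMap]
  exact RatFunc.algebraMap_ne_zero (Polynomial.X_sub_C_ne_zero a)

theorem not_isPole_X_sub_C (a z : ℂ) : ¬ IsPole (RatFunc.X - RatFunc.C a) z := by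
  rw [X_sub_C_eq_algebraMap, IsPole, RatFunc.denom_algebraMap]
  simp

theorem ratVal_X_sub_C (a z : ℂ) : ratVal (RatFunc.X - RatFunc.C a) z = z - a := by
  rw [X_sub_C_eq_algebraMap, ratVal_eq_div, RatFunc.denom_algebraMap, RatFunc.num_algebraMap]
  simp

theorem ratVal_pole_term {z₀ z : ℂ} (ε : ℝ) (hz : z ≠ z₀) :
    ¬ IsPole (RatFunc.C (ε : ℂ) / (RatFunc.X - RatFunc.C z₀)) z ∧
      ratVal (RatFunc.C (ε : ℂ) / (RatFunc.X - RatFunc.C z₀)) z = ε / (z - z₀) := by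
  have hsub : z - z₀ ≠ 0 := sub_ne_zero.2 hz
  have hp : ¬ IsPole (RatFunc.C (ε : ℂ) / (RatFunc.X - RatFunc.C z₀)) z := by
    rw [X_sub_C_eq_algebraMap, ← RatFunc.algebraMap_C]
    exact not_isPole_of_denom_dvd (RatFunc.denom_div_dvd _ _) (by simpa using hsub)
  refine ⟨hp, ?_⟩
  have h := ratVal_mul hp (not_isPole_X_sub_C z₀ z)
  rw [div_mul_cancel₀ _ (X_sub_C_ne_zero z₀), ratVal_C, ratVal_X_sub_C] at h
  rw [eq_div_iff hsub, ← h]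

theorem isPole_perturb_iff {R : RatFunc ℂ} {z₀ z : ℂ} (ε : ℝ) (hz : z ≠ z₀) :
    IsPole (perturb R z₀ ε) z ↔ IsPole R z := by
  rw [← not_iff_not]
  refine ⟨fun h => ?_, fun h => not_isPole_add h (ratVal_pole_term ε hz).1⟩
  have : R = perturb R z₀ ε + RatFunc.C (((-ε : ℝ)) : ℂ) / (RatFunc.X - RatFunc.C z₀) := by
    unfold perturb
    rw [add_assoc, ← add_div, ← map_add]
    simp
  rw [this]
  exact not_isPole_add h (ratVal_pole_term (-ε) hz).1

theorem ratVal_perturb {R : RatFunc ℂ} {z₀ z : ℂ} (ε : ℝ) (hz : z ≠ z₀) (hR : ¬ IsPole R z) :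
    ratVal (perturb R z₀ ε) z = ratVal R z + ε / (z - z₀) := by
  have h := ratVal_pole_term ε hz
  rw [perturb, ratVal_add hR h.1, h.2]

theorem isPole_perturb_self {R : RatFunc ℂ} {z₀ : ℂ} {ε : ℝ} (hε : ε ≠ 0) (hR : ¬ IsPole R z₀) :
    IsPole (perturb R z₀ ε) z₀ := by
  by_contra h
  have hpX := not_isPole_X_sub_C z₀ z₀
  have heq : perturb R z₀ ε * (RatFunc.X - RatFunc.C z₀) =
      R * (RatFunc.X - RatFunc.C z₀) + RatFunc.C (ε : ℂ) := by
    rw [perturb, add_mul, div_mul_cancel₀ _ (X_sub_C_ne_zero z₀)]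
  have h1 : ratVal (perturb R z₀ ε * (RatFunc.X - RatFunc.C z₀)) z₀ =
      ratVal (R * (RatFunc.X - RatFunc.C z₀) + RatFunc.C (ε : ℂ)) z₀ := by rw [heq]
  rw [ratVal_mul h hpX, ratVal_add (not_isPole_mul hR hpX) (not_isPole_C _ _),
    ratVal_mul hR hpX, ratVal_C, ratVal_X_sub_C] at h1
  simp only [sub_self, mul_zero, zero_add] at h1
  exact hε (by exact_mod_cast h1.symm)

/-- The zeros of `F` are the points `z ≠ z₀`, not poles of `R`, that satisfy
`(z - z₀) (R(z) - conj z₀) = |z - z₀|² - ε`. -/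
theorem isZero_perturb_iff {R : RatFunc ℂ} {z₀ z : ℂ} {ε : ℝ} (hε : ε ≠ 0)
    (hR : ¬ IsPole R z₀) :
    IsZero (perturb R z₀ ε) z ↔ z ≠ z₀ ∧ ¬ IsPole R z ∧
      (z - z₀) * (ratVal R z - conj z₀) = ((‖z - z₀‖ ^ 2 - ε : ℝ) : ℂ) := by
  by_cases hz : z = z₀
  · subst hz
    simp [IsZero, isPole_perturb_self hε hR]
  have hsub : z - z₀ ≠ 0 := sub_ne_zero.2 hz
  simp only [IsZero, isPole_perturb_iff ε hz, ne_eq, hz, not_false_eq_true, true_and]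
  refine and_congr_right fun hp => ?_
  rw [harm, ratVal_perturb ε hz hp]
  have hn : ((‖z - z₀‖ ^ 2 - ε : ℝ) : ℂ) = (z - z₀) * (conj z - conj z₀) - ε := by
    rw [← map_sub, Complex.mul_conj']
    push_cast; rfl
  rw [hn]
  constructor
  · intro h
    have h2 : (z - z₀) * (ratVal R z + ε / (z - z₀) - conj z) = 0 := by rw [h, mul_zero]
    field_simp at h2
    linear_combination h2
  · intro h
    apply mul_left_cancel₀ hsub
    field_simp
    linear_combination h

/-! ### Zeros of the perturbation near the center -/

/-- `R - conj z₀` has a zero of order exactly `m + 2` at `z₀`. Here and below `n = m + 3`, which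
keeps natural subtraction out of the exponents. -/
theorem exists_local_form {R : RatFunc ℂ} {z₀ : ℂ} {m : ℕ} (hz₀ : IsZero R z₀)
    (hvanish : ∀ k : ℕ, 1 ≤ k → k ≤ m + 1 → iteratedDeriv k (ratVal R) z₀ = 0)
    (hnonzero : iteratedDeriv (m + 2) (ratVal R) z₀ ≠ 0) :
    ∃ k : ℂ → ℂ, AnalyticAt ℂ k z₀ ∧ k z₀ ≠ 0 ∧
      ∀ᶠ z in 𝓝 z₀, ratVal R z = conj z₀ + (z - z₀) ^ (m + 2) * k z := by
  have hR := analyticAt_ratVal hz₀.1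
  have hA : AnalyticAt ℂ (fun z => ratVal R z - conj z₀) z₀ := hR.sub analyticAt_const
  have hd : ∀ j, 1 ≤ j → iteratedDeriv j (fun z => ratVal R z - conj z₀) z₀ =
      iteratedDeriv j (ratVal R) z₀ := by
    intro j hj
    obtain ⟨i, rfl⟩ : ∃ i, j = i + 1 := ⟨j - 1, by omega⟩
    rw [iteratedDeriv_succ', iteratedDeriv_succ']
    congr 1
    funext z
    exact deriv_sub_const (f := ratVal R) _
  have hord : analyticOrderAt (fun z => ratVal R z - conj z₀) z₀ = ((m + 2 : ℕ) : ℕ∞) := by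
    rw [analyticOrderAt_eq_nat_iff_iteratedDeriv_eq_zero hA]
    refine ⟨fun j hj => ?_, by rw [hd _ (by omega)]; exact hnonzero⟩
    rcases Nat.eq_zero_or_pos j with rfl | hj0
    · simpa [harm] using hz₀.2
    · rw [hd j hj0]; exact hvanish j hj0 (by omega)
  obtain ⟨k, hk, hk0, he⟩ := hA.analyticOrderAt_eq_natCast.1 hord
  refine ⟨k, hk, hk0, he.mono fun z hz => ?_⟩
  rw [smul_eq_mul] at hz
  linear_combination hz

/-- The size of `h(z) = (z - z₀) (R(z) - conj z₀)` near `z₀`, and its logarithmic derivative: as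
`h` vanishes to order `m + 3` at `z₀`, it is `o(|z - z₀|²)`, and
`(z - z₀) h'(z) = (m + 3 + o(1)) h(z)`. -/
theorem eventually_local_estimates {R : RatFunc ℂ} {z₀ : ℂ} {m : ℕ} {k : ℂ → ℂ}
    (hk : AnalyticAt ℂ k z₀) (hk0 : k z₀ ≠ 0)
    (hform : ∀ᶠ z in 𝓝 z₀, ratVal R z = conj z₀ + (z - z₀) ^ (m + 2) * k z) {δ : ℝ} (hδ : 0 < δ) :
    ∀ᶠ z in 𝓝 z₀, (z ≠ z₀ → ‖(z - z₀) * (ratVal R z - conj z₀)‖ < ‖z - z₀‖ ^ 2 * δ) ∧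
      ∃ e : ℂ, ‖e‖ ≤ 1 / 2 ∧
        (z - z₀) ^ 2 * deriv (ratVal R) z =
          ((m + 2) + e) * ((z - z₀) * (ratVal R z - conj z₀)) := by
  have h1 : ∀ᶠ z in 𝓝 z₀, ‖(z - z₀) ^ (m + 1) * k z‖ < δ := by
    have hc : ContinuousAt (fun z => ‖(z - z₀) ^ (m + 1) * k z‖) z₀ :=
      (((continuousAt_id.sub continuousAt_const).pow _).mul hk.continuousAt).norm
    exact hc.eventually_lt continuousAt_const (by simpa using hδ)
  have h2 : ∀ᶠ z in 𝓝 z₀, ‖(z - z₀) * deriv k z / k z‖ < 1 / 2 := by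
    have hc : ContinuousAt (fun z => ‖(z - z₀) * deriv k z / k z‖) z₀ :=
      (((continuousAt_id.sub continuousAt_const).mul hk.deriv.continuousAt).div
        hk.continuousAt hk0).norm
    exact hc.eventually_lt continuousAt_const (by simp)
  filter_upwards [h1, h2, hform.eventually_nhds, hk.eventually_analyticAt,
    hk.continuousAt.eventually_ne hk0] with z h1 h2 h3 h4 h5
  have hz := h3.self_of_nhds
  refine ⟨fun hne => ?_, (z - z₀) * deriv k z / k z, h2.le, ?_⟩
  · have : (z - z₀) * (ratVal R z - conj z₀) = (z - z₀) ^ 2 * ((z - z₀) ^ (m + 1) * k z) := by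
      rw [hz]; ring
    rw [this, norm_mul, norm_pow]
    have : 0 < ‖z - z₀‖ := norm_pos_iff.2 (sub_ne_zero.2 hne)
    exact mul_lt_mul_of_pos_left h1 (by positivity)
  · have hd : deriv (ratVal R) z =
        (m + 2) * (z - z₀) ^ (m + 1) * k z + (z - z₀) ^ (m + 2) * deriv k z := by
      rw [Filter.EventuallyEq.deriv_eq h3]
      have hp : HasDerivAt (fun z => (z - z₀) ^ (m + 2)) ((m + 2) * (z - z₀) ^ (m + 1)) z := by
        simpa using ((hasDerivAt_id z).sub_const z₀).fun_pow (m + 2)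
      exact ((hp.mul h4.differentiableAt.hasDerivAt).const_add _).deriv
    rw [hd, hz]
    field_simp
    ring

/-- A holomorphic function with a zero of order `N` is the `N`-th power of a local coordinate;
`ψ` is the inverse of such a coordinate. -/
theorem exists_root_coordinate {z₀ : ℂ} {N : ℕ} (hN : N ≠ 0) {k : ℂ → ℂ}
    (hk : AnalyticAt ℂ k z₀) (hk0 : k z₀ ≠ 0) {P : ℂ → Prop} (hP : ∀ᶠ z in 𝓝 z₀, P z) :
    ∃ t₁ : ℝ, 0 < t₁ ∧ ∃ ψ : ℂ → ℂ, ψ 0 = z₀ ∧ ContinuousOn ψ (closedBall 0 t₁) ∧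
      Set.InjOn ψ (closedBall 0 t₁) ∧
      ∀ u ∈ closedBall (0 : ℂ) t₁, P (ψ u) ∧ (ψ u - z₀) ^ N * k (ψ u) = u ^ N := by
  obtain ⟨c, hc⟩ := IsAlgClosed.exists_pow_nat_eq (k z₀) (Nat.pos_of_ne_zero hN)
  have hc0 : c ≠ 0 := by
    rintro rfl
    exact hk0 (by rw [← hc, zero_pow hN])
  -- dividing by `k z₀` moves the base of the power near `1`, off the branch cut
  set g : ℂ → ℂ := fun z => c * (k z / k z₀) ^ ((N : ℂ)⁻¹) with hg
  have hgA : AnalyticAt ℂ g z₀ := by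
    refine analyticAt_const.mul ((hk.div analyticAt_const hk0).cpow analyticAt_const ?_)
    simp [div_self hk0]
  have hg0 : g z₀ = c := by simp [hg, div_self hk0]
  have hgN : ∀ z, g z ^ N = k z := by
    intro z
    simp only [hg]
    rw [mul_pow, Complex.cpow_nat_inv_pow _ hN, hc]
    field_simp
  -- the local coordinate with `φ ^ N = (z - z₀) ^ N * k`
  set φ : ℂ → ℂ := fun z => (z - z₀) * g z with hφ
  have hφA : AnalyticAt ℂ φ z₀ := (analyticAt_id.sub analyticAt_const).mul hgA
  have hderiv : deriv φ z₀ = c := by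
    have := (((hasDerivAt_id z₀).sub_const z₀).mul hgA.differentiableAt.hasDerivAt).deriv
    simp only [id, sub_self, zero_mul, add_zero, one_mul, hg0] at this
    exact this
  have hstrict : HasStrictDerivAt φ c z₀ := hderiv ▸ hφA.hasStrictDerivAt
  set e := (hstrict.hasStrictFDerivAt_equiv hc0).toOpenPartialHomeomorph φ with he
  have hcoe : (e : ℂ → ℂ) = φ := rfl
  have hmem : z₀ ∈ e.source :=
    (hstrict.hasStrictFDerivAt_equiv hc0).mem_toOpenPartialHomeomorph_source
  have hφ0 : φ z₀ = 0 := by simp [hφ]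
  have h0t : (0 : ℂ) ∈ e.target := by
    have := e.map_source hmem
    rwa [hcoe, hφ0] at this
  have hsymm0 : e.symm 0 = z₀ := by
    have := e.left_inv hmem
    rwa [hcoe, hφ0] at this
  have hcont : ContinuousAt e.symm 0 := e.continuousAt_symm h0t
  have hev : ∀ᶠ u in 𝓝 (0 : ℂ), u ∈ e.target ∧ P (e.symm u) := by
    refine (e.open_target.eventually_mem h0t).and (hcont.eventually ?_)
    rwa [hsymm0]
  obtain ⟨t₁, ht₁, hb⟩ := Metric.nhds_basis_closedBall.eventually_iff.1 hev
  refine ⟨t₁, ht₁, e.symm, hsymm0, e.continuousOn_symm.mono fun u hu => (hb hu).1,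
    e.symm.injOn.mono fun u hu => (hb hu).1, fun u hu => ⟨(hb hu).2, ?_⟩⟩
  have : φ (e.symm u) = u := e.right_inv (hb hu).1
  rw [← hgN, ← mul_pow]
  exact congrArg (· ^ N) this

/-- On the ray in direction `ω`, with `ω ^ N = σ = ± 1`, the equation `h = |z - z₀|² - ε` becomes
a real equation in one variable, which the intermediate value theorem solves. -/
theorem eventually_exists_zero_on_ray {z₀ : ℂ} {N : ℕ} (hN : N ≠ 0) {t₁ : ℝ} (ht₁ : 0 < t₁)
    {ψ : ℂ → ℂ} (hψ0 : ψ 0 = z₀) (hψ : ContinuousOn ψ (closedBall 0 t₁))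
    {σ : ℝ} (hσ : |σ| = 1) {ω : ℂ} (hω : ω ^ N = σ)
    (hsmall : ∀ u ∈ closedBall (0 : ℂ) t₁, u ≠ 0 → ‖u ^ N‖ < ‖ψ u - z₀‖ ^ 2) :
    ∀ᶠ ε in 𝓝[>] (0 : ℝ), ∃ t ∈ Set.Ioc 0 t₁,
      ‖ψ (t * ω) - z₀‖ ^ 2 - ε = σ * t ^ N := by
  have hω1 : ‖ω‖ = 1 := by
    have := congrArg norm hω
    rw [norm_pow, Complex.norm_real, Real.norm_eq_abs, hσ] at this
    exact (pow_eq_one_iff_of_nonneg (norm_nonneg _) hN).1 this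
  have hnorm : ∀ t : ℝ, 0 ≤ t → ‖(t : ℂ) * ω‖ = t := fun t ht => by
    rw [norm_mul, hω1, mul_one, Complex.norm_real, Real.norm_of_nonneg ht]
  have hmem : ∀ t ∈ Set.Icc 0 t₁, (t : ℂ) * ω ∈ closedBall (0 : ℂ) t₁ := fun t ht => by
    rw [mem_closedBall_zero_iff, hnorm t ht.1]; exact ht.2
  set G : ℝ → ℝ := fun t => ‖ψ (t * ω) - z₀‖ ^ 2 - σ * t ^ N with hG
  have hGc : ContinuousOn G (Set.Icc 0 t₁) := by
    have h1 : ContinuousOn (fun t : ℝ => ψ (t * ω)) (Set.Icc 0 t₁) :=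
      hψ.comp (by fun_prop) hmem
    exact (((h1.sub continuousOn_const).norm).pow 2).sub (by fun_prop)
  have hG0 : G 0 = 0 := by simp [hG, hψ0, hN]
  have hG1 : 0 < G t₁ := by
    have hu := hsmall _ (hmem t₁ ⟨ht₁.le, le_rfl⟩)
      (by rw [← norm_pos_iff, hnorm t₁ ht₁.le]; exact ht₁)
    rw [norm_pow, hnorm t₁ ht₁.le] at hu
    have : σ * t₁ ^ N ≤ t₁ ^ N := by
      have : σ ≤ 1 := hσ ▸ le_abs_self σ
      nlinarith [pow_pos ht₁ N]
    simp only [hG]; linarith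
  filter_upwards [Ioo_mem_nhdsGT hG1] with ε hε
  obtain ⟨t, ht, hte⟩ := intermediate_value_Icc ht₁.le hGc (show ε ∈ Set.Icc (G 0) (G t₁) from
    ⟨hG0.le.trans hε.1.le, hε.2.le⟩)
  refine ⟨t, ⟨lt_of_le_of_ne ht.1 ?_, ht.2⟩, ?_⟩
  · rintro rfl
    rw [hG0] at hte
    exact hε.1.ne hte
  · simp only [hG] at hte
    linarith

/-- The `n = m + 3` directions `ω` with `ω ^ n = σ` give `n` distinct zeros of `F` near `z₀` at
which `|z - z₀|² - ε` has the sign `σ`. -/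
theorem eventually_le_encard_zeros {R : RatFunc ℂ} {z₀ : ℂ} {m : ℕ} (hz₀ : ¬ IsPole R z₀)
    {k : ℂ → ℂ} (hk : AnalyticAt ℂ k z₀) (hk0 : k z₀ ≠ 0)
    (hform : ∀ᶠ z in 𝓝 z₀, ratVal R z = conj z₀ + (z - z₀) ^ (m + 2) * k z)
    {ρ : ℝ} (hρ : 0 < ρ) {σ : ℝ} (hσ : |σ| = 1) :
    ∀ᶠ ε in 𝓝[>] (0 : ℝ), ((m + 3 : ℕ) : ℕ∞) ≤ Set.encard {z | ‖z - z₀‖ < ρ ∧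
      IsZero (perturb R z₀ ε) z ∧ 0 < σ * (‖z - z₀‖ ^ 2 - ε)} := by
  have hN : m + 3 ≠ 0 := by omega
  have hev : ∀ᶠ z in 𝓝 z₀, ‖z - z₀‖ < ρ ∧ ¬ IsPole R z ∧
      ratVal R z = conj z₀ + (z - z₀) ^ (m + 2) * k z ∧
      (z ≠ z₀ → ‖(z - z₀) * (ratVal R z - conj z₀)‖ < ‖z - z₀‖ ^ 2 * 1) := by
    filter_upwards [Metric.ball_mem_nhds z₀ hρ, (isOpen_setOf_not_isPole R).mem_nhds hz₀, hform,
      eventually_local_estimates hk hk0 hform one_pos] with z h1 h2 h3 h4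
    exact ⟨by rwa [← dist_eq_norm], h2, h3, h4.1⟩
  obtain ⟨t₁, ht₁, ψ, hψ0, hψc, hψi, hψ⟩ := exists_root_coordinate hN hk hk0 hev
  have h0mem : (0 : ℂ) ∈ closedBall (0 : ℂ) t₁ := mem_closedBall_self ht₁.le
  have hh : ∀ u ∈ closedBall (0 : ℂ) t₁,
      (ψ u - z₀) * (ratVal R (ψ u) - conj z₀) = u ^ (m + 3) := by
    intro u hu
    rw [← (hψ u hu).2, (hψ u hu).1.2.2.1]; ring
  have hsmall : ∀ u ∈ closedBall (0 : ℂ) t₁, u ≠ 0 → ‖u ^ (m + 3)‖ < ‖ψ u - z₀‖ ^ 2 := by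
    intro u hu hu0
    have hne : ψ u ≠ z₀ := fun h => hu0 (hψi hu h0mem (by rw [h, hψ0]))
    have := (hψ u hu).1.2.2.2 hne
    rwa [hh u hu, mul_one] at this
  obtain ⟨α, hα⟩ := IsAlgClosed.exists_pow_nat_eq (σ : ℂ) (Nat.pos_of_ne_zero hN)
  set ζ : ℂ := Complex.exp (2 * Real.pi * Complex.I / ((m + 3 : ℕ) : ℂ)) with hζ
  have hprim : IsPrimitiveRoot ζ (m + 3) := Complex.isPrimitiveRoot_exp (m + 3) hN
  have hω : ∀ j : Fin (m + 3), (α * ζ ^ (j : ℕ)) ^ (m + 3) = σ := by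
    intro j
    rw [mul_pow, hα, ← pow_mul, mul_comm (j : ℕ), pow_mul, hprim.pow_eq_one, one_pow, mul_one]
  have hω1 : ∀ j : Fin (m + 3), ‖α * ζ ^ (j : ℕ)‖ = 1 := by
    intro j
    have := congrArg norm (hω j)
    rw [norm_pow, Complex.norm_real, Real.norm_eq_abs, hσ] at this
    exact (pow_eq_one_iff_of_nonneg (norm_nonneg _) hN).1 this
  have hα0 : α ≠ 0 := by
    have h := hω1 0
    rintro rfl
    simp at h
  have hall : ∀ᶠ ε in 𝓝[>] (0 : ℝ), ∀ j : Fin (m + 3), ∃ t ∈ Set.Ioc 0 t₁,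
      ‖ψ (t * (α * ζ ^ (j : ℕ))) - z₀‖ ^ 2 - ε = σ * t ^ (m + 3) :=
    eventually_all.2 fun j =>
      eventually_exists_zero_on_ray hN ht₁ hψ0 hψc hσ (hω j) hsmall
  filter_upwards [hall, self_mem_nhdsWithin] with ε hε hε0
  choose t ht hte using hε
  set Z : Fin (m + 3) → ℂ := fun j => ψ (t j * (α * ζ ^ (j : ℕ))) with hZ
  have hnorm : ∀ j, ‖(t j : ℂ) * (α * ζ ^ (j : ℕ))‖ = t j := fun j => by
    rw [norm_mul, hω1, mul_one, Complex.norm_real, Real.norm_of_nonneg (ht j).1.le]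
  have hmem : ∀ j, (t j : ℂ) * (α * ζ ^ (j : ℕ)) ∈ closedBall (0 : ℂ) t₁ := fun j => by
    rw [mem_closedBall_zero_iff, hnorm]; exact (ht j).2
  have hinj : Function.Injective Z := by
    intro i j hij
    have h := hψi (hmem i) (hmem j) hij
    have htt : t i = t j := by rw [← hnorm i, ← hnorm j, h]
    have ht0 : (t j : ℂ) ≠ 0 := by exact_mod_cast (ht j).1.ne'
    rw [htt] at h
    have h2 := mul_left_cancel₀ hα0 (mul_left_cancel₀ ht0 h)
    exact Fin.ext (hprim.pow_inj i.2 j.2 h2)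
  have hcard : Set.encard (Set.range Z) = ((m + 3 : ℕ) : ℕ∞) := by
    rw [← Set.image_univ, hinj.encard_image]; simp
  rw [← hcard]
  apply Set.encard_le_encard
  rintro _ ⟨j, rfl⟩
  have hu0 : (t j : ℂ) * (α * ζ ^ (j : ℕ)) ≠ 0 := by
    rw [← norm_pos_iff, hnorm]; exact (ht j).1
  have hne : Z j ≠ z₀ := fun h => hu0 (hψi (hmem j) h0mem (by rw [hψ0]; exact h))
  have hp := (hψ _ (hmem j)).1
  refine ⟨hp.1, (isZero_perturb_iff (ne_of_gt hε0) hz₀).2 ⟨hne, hp.2.1, ?_⟩, ?_⟩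
  · have h := hte j
    simp only [hZ]
    rw [hh _ (hmem j), h, mul_pow, hω j]
    push_cast; ring
  · have h := hte j
    have hσ2 : σ * σ = 1 := by rw [← abs_mul_abs_self, hσ, one_mul]
    simp only [hZ]
    rw [h, ← mul_assoc, hσ2, one_mul]
    exact pow_pos (ht j).1 _

theorem hasDerivAt_ratVal_perturb {R : RatFunc ℂ} {z₀ z : ℂ} (ε : ℝ) (hz : z ≠ z₀)
    (hR : ¬ IsPole R z) :
    HasDerivAt (ratVal (perturb R z₀ ε)) (deriv (ratVal R) z - ε / (z - z₀) ^ 2) z := by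
  have hsub : z - z₀ ≠ 0 := sub_ne_zero.2 hz
  have h1 : HasDerivAt (fun z => (ε : ℂ) / (z - z₀)) (-ε / (z - z₀) ^ 2) z := by
    simpa using (hasDerivAt_const z (ε : ℂ)).fun_div ((hasDerivAt_id z).sub_const z₀) hsub
  have h2 := (analyticAt_ratVal hR).differentiableAt.hasDerivAt.fun_add h1
  rw [neg_div, ← sub_eq_add_neg] at h2
  refine h2.congr_of_eventuallyEq ?_
  filter_upwards [eventually_ne_nhds hz, (isOpen_setOf_not_isPole R).mem_nhds hR] with w h3 h4
  exact ratVal_perturb ε h3 h4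

/-- At a zero of `F` the number `h = (z - z₀) (R(z) - conj z₀)` is the real number `|z - z₀|² - ε`,
and `(z - z₀)² F'(z) = (n - 1 + o(1)) h - ε`, where `F'` is the derivative of the rational part.
So the sign of `h` decides both on which side of the circle of radius `√ε` the zero lies and
whether the zero preserves the sense. -/
theorem zero_near_center {R : RatFunc ℂ} {z₀ z : ℂ} {m : ℕ} {ε : ℝ} (hε : 0 < ε)
    (hz₀ : ¬ IsPole R z₀)
    (h1 : z ≠ z₀ → ‖(z - z₀) * (ratVal R z - conj z₀)‖ < ‖z - z₀‖ ^ 2 * (1 / (m + 3)))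
    (h2 : ∃ e : ℂ, ‖e‖ ≤ 1 / 2 ∧ (z - z₀) ^ 2 * deriv (ratVal R) z =
          ((m + 2) + e) * ((z - z₀) * (ratVal R z - conj z₀)))
    (hz : IsZero (perturb R z₀ ε) z) :
    ε * (m + 2) < ‖z - z₀‖ ^ 2 * (m + 3) ∧ ‖z - z₀‖ ^ 2 * (m + 2) < ε * (m + 3) ∧
      (‖z - z₀‖ ^ 2 < ε → 1 < ‖deriv (ratVal (perturb R z₀ ε)) z‖) ∧
      (ε < ‖z - z₀‖ ^ 2 → ‖deriv (ratVal (perturb R z₀ ε)) z‖ < 1) := by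
  obtain ⟨hne, hp, hh⟩ := (isZero_perturb_iff hε.ne' hz₀).1 hz
  have hsub : z - z₀ ≠ 0 := sub_ne_zero.2 hne
  have h1 := h1 hne
  obtain ⟨e, he, h2⟩ := h2
  rw [hh] at h1 h2
  rw [(hasDerivAt_ratVal_perturb ε hne hp).deriv]
  have hs : 0 < ‖z - z₀‖ ^ 2 := pow_pos (norm_pos_iff.2 hsub) 2
  have hnorm : ‖deriv (ratVal R) z - ε / (z - z₀) ^ 2‖ * ‖z - z₀‖ ^ 2 =
      ‖(((m + 2) * (‖z - z₀‖ ^ 2 - ε) - ε : ℝ) : ℂ) + e * ((‖z - z₀‖ ^ 2 - ε : ℝ) : ℂ)‖ := by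
    rw [show ‖deriv (ratVal R) z - ε / (z - z₀) ^ 2‖ * ‖z - z₀‖ ^ 2 =
      ‖(deriv (ratVal R) z - ε / (z - z₀) ^ 2) * (z - z₀) ^ 2‖ by rw [norm_mul, norm_pow]]
    congr 1
    rw [sub_mul, mul_comm, h2]
    field_simp
    push_cast
    ring
  set s := ‖z - z₀‖ ^ 2 with hsdef
  set D := ‖deriv (ratVal R) z - ε / (z - z₀) ^ 2‖ with hD
  rw [Complex.norm_real, Real.norm_eq_abs] at h1
  have hm : (0 : ℝ) ≤ m := Nat.cast_nonneg m
  rw [mul_one_div, lt_div_iff₀ (by positivity)] at h1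
  have hex : ‖e * ((s - ε : ℝ) : ℂ)‖ ≤ |s - ε| / 2 := by
    rw [norm_mul, Complex.norm_real, Real.norm_eq_abs]
    nlinarith [abs_nonneg (s - ε)]
  have hx1 := le_abs_self (s - ε)
  have hx2 := neg_le_abs (s - ε)
  have hA : ε * (m + 2) < s * (m + 3) := by nlinarith
  have hB : s * (m + 2) < ε * (m + 3) := by nlinarith
  refine ⟨hA, hB, fun hlt => ?_, fun hlt => ?_⟩
  · have hr : ‖(((m + 2) * (s - ε) - ε : ℝ) : ℂ)‖ = (m + 2) * (ε - s) + ε := by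
      rw [Complex.norm_real, Real.norm_eq_abs, abs_of_neg (by nlinarith)]; ring
    have := norm_sub_le_norm_add (((m + 2) * (s - ε) - ε : ℝ) : ℂ) (e * ((s - ε : ℝ) : ℂ))
    rw [hr, ← hnorm] at this
    rw [abs_of_neg (by linarith)] at hex
    have h5 : s < D * s := by nlinarith
    by_contra hcon
    nlinarith
  · have hr : ‖(((m + 2) * (s - ε) - ε : ℝ) : ℂ)‖ = ε - (m + 2) * (s - ε) := by
      rw [Complex.norm_real, Real.norm_eq_abs, abs_of_neg (by nlinarith)]; ring
    have := norm_add_le (((m + 2) * (s - ε) - ε : ℝ) : ℂ) (e * ((s - ε : ℝ) : ℂ))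
    rw [hr, ← hnorm] at this
    rw [abs_of_pos (by linarith)] at hex
    have h5 : D * s < s := by nlinarith
    by_contra hcon
    nlinarith

/-- In a disk around `z₀` whose radius does not depend on `ε`, the only zero of `f` is `z₀`, every
zero of `F` lies in the annulus `η⁻¹ √ε < |z - z₀| < η √ε`, and at least `n` of them on either side
of the circle of radius `√ε` have the asserted sense. -/
theorem exists_near_center {R : RatFunc ℂ} {z₀ : ℂ} {m : ℕ} (hz₀ : IsZero R z₀)
    (hvanish : ∀ k : ℕ, 1 ≤ k → k ≤ m + 1 → iteratedDeriv k (ratVal R) z₀ = 0)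
    (hnonzero : iteratedDeriv (m + 2) (ratVal R) z₀ ≠ 0)
    {η : ℝ} (hη : η = Real.sqrt ((m + 3 : ℝ) / (m + 2))) :
    ∃ ρ : ℝ, 0 < ρ ∧ (∀ z, ‖z - z₀‖ < ρ → IsZero R z → z = z₀) ∧
      ∀ᶠ ε in 𝓝[>] (0 : ℝ), η * Real.sqrt ε < ρ ∧
        (∀ z, ‖z - z₀‖ < ρ → IsZero (perturb R z₀ ε) z →
          η⁻¹ * Real.sqrt ε < ‖z - z₀‖ ∧ ‖z - z₀‖ < η * Real.sqrt ε) ∧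
        ((m + 3 : ℕ) : ℕ∞) ≤ Set.encard
          {z | z ∈ annulus z₀ (η⁻¹ * Real.sqrt ε) (Real.sqrt ε) ∧
            IsSensePreservingZero (perturb R z₀ ε) z} ∧
        ((m + 3 : ℕ) : ℕ∞) ≤ Set.encard
          {z | z ∈ annulus z₀ (Real.sqrt ε) (η * Real.sqrt ε) ∧
            IsSenseReversingZero (perturb R z₀ ε) z} := by
  have hm : (0 : ℝ) ≤ m := Nat.cast_nonneg m
  have hη0 : 0 < η := by rw [hη]; positivity
  have hη2 : η ^ 2 = (m + 3 : ℝ) / (m + 2) := by rw [hη, Real.sq_sqrt (by positivity)]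
  obtain ⟨k, hk, hk0, hform⟩ := exists_local_form hz₀ hvanish hnonzero
  have hest := eventually_local_estimates hk hk0 hform (δ := 1 / (m + 3)) (by positivity)
  obtain ⟨ρ, hρ, hball⟩ := Metric.eventually_nhds_iff.1 hest
  have hball : ∀ z, ‖z - z₀‖ < ρ → _ := fun z hz => hball (show dist z z₀ < ρ by rwa [dist_eq_norm])
  have hlim : ∀ᶠ ε in 𝓝[>] (0 : ℝ), η * Real.sqrt ε < ρ := by
    have hc : ContinuousAt (fun ε => η * Real.sqrt ε) 0 := by fun_prop
    exact (hc.eventually_lt continuousAt_const (by simpa using hρ)).filter_mono nhdsWithin_le_nhds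
  refine ⟨ρ, hρ, fun z hz hzero => ?_, ?_⟩
  · by_contra hne
    have h1 := (hball z hz).1 hne
    have hs : 0 < ‖z - z₀‖ := norm_pos_iff.2 (sub_ne_zero.2 hne)
    rw [show ratVal R z = conj z from sub_eq_zero.1 hzero.2, ← map_sub, norm_mul,
      Complex.norm_conj, ← sq, mul_one_div, lt_div_iff₀ (by positivity)] at h1
    nlinarith [pow_pos hs 2]
  have hzero : ∀ ε : ℝ, 0 < ε → ∀ z, ‖z - z₀‖ < ρ → IsZero (perturb R z₀ ε) z →
      (η⁻¹ * Real.sqrt ε < ‖z - z₀‖ ∧ ‖z - z₀‖ < η * Real.sqrt ε) ∧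
      (‖z - z₀‖ ^ 2 < ε → 1 < ‖deriv (ratVal (perturb R z₀ ε)) z‖) ∧
      (ε < ‖z - z₀‖ ^ 2 → ‖deriv (ratVal (perturb R z₀ ε)) z‖ < 1) := by
    intro ε hε z hz hF
    obtain ⟨hA, hB, hC⟩ := zero_near_center hε hz₀.1 (hball z hz).1 (hball z hz).2 hF
    refine ⟨⟨?_, ?_⟩, hC⟩
    · refine lt_of_pow_lt_pow_left₀ 2 (norm_nonneg _) ?_
      rw [mul_pow, inv_pow, hη2, Real.sq_sqrt hε.le, inv_div, div_mul_eq_mul_div,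
        div_lt_iff₀ (by positivity)]
      linarith
    · refine lt_of_pow_lt_pow_left₀ 2 (by positivity) ?_
      rw [mul_pow, hη2, Real.sq_sqrt hε.le, div_mul_eq_mul_div, lt_div_iff₀ (by positivity)]
      linarith
  filter_upwards [hlim, self_mem_nhdsWithin,
    eventually_le_encard_zeros hz₀.1 hk hk0 hform hρ (σ := -1) (by simp),
    eventually_le_encard_zeros hz₀.1 hk hk0 hform hρ (σ := 1) (by simp)] with ε h1 h2 h3 h4
  have h2 : 0 < ε := h2
  refine ⟨h1, fun z hz hF => (hzero ε h2 z hz hF).1, h3.trans (Set.encard_le_encard ?_),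
    h4.trans (Set.encard_le_encard ?_)⟩
  · rintro z ⟨hz, hF, hs⟩
    have hs : ‖z - z₀‖ ^ 2 < ε := by linarith
    obtain ⟨⟨ha, hb⟩, hc, hd⟩ := hzero ε h2 z hz hF
    refine ⟨⟨by rwa [dist_eq_norm], ?_⟩, hF, hc hs⟩
    rw [dist_eq_norm]
    exact Real.lt_sqrt_of_sq_lt hs
  · rintro z ⟨hz, hF, hs⟩
    have hs : ε < ‖z - z₀‖ ^ 2 := by linarith
    obtain ⟨⟨ha, hb⟩, hc, hd⟩ := hzero ε h2 z hz hF
    refine ⟨⟨?_, by rwa [dist_eq_norm]⟩, hF, hd hs⟩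
    rw [dist_eq_norm]
    exact (Real.sqrt_lt' (lt_of_le_of_lt (by positivity) ha)).2 hs

/-! ### The index of a regular zero -/

/-- If `f ∘ γ` is `c e^{i d t}` times a closed curve `ρ` in the disk of radius `1` around `1`, its
winding is `d`: the principal argument of `ρ` is continuous and contributes nothing. -/
theorem hasWinding_of_polar {f : ℂ → ℂ} {γ : ℝ → ℂ} {a b : ℝ} {d : ℤ} {ρ : ℝ → ℂ} {c : ℂ}
    (hc : c ≠ 0) (hρc : ContinuousOn ρ (Set.Icc a b)) (hρ : ∀ t ∈ Set.Icc a b, ‖ρ t - 1‖ < 1)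
    (hper : ρ a = ρ b) (hab : b - a = 2 * Real.pi)
    (hf : ∀ t, f (γ t) = c * Complex.exp ((d * t : ℝ) * Complex.I) * ρ t) :
    HasWinding f γ a b d := by
  have hslit : ∀ t ∈ Set.Icc a b, ρ t ∈ Complex.slitPlane := by
    intro t ht
    left
    have h1 := (Complex.abs_re_le_norm (ρ t - 1)).trans_lt (hρ t ht)
    rw [Complex.sub_re, Complex.one_re, abs_lt] at h1
    linarith [h1.1]
  have hne : ∀ t ∈ Set.Icc a b, f (γ t) ≠ 0 := by
    intro t ht
    rw [hf]
    exact mul_ne_zero (mul_ne_zero hc (Complex.exp_ne_zero _))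
      (Complex.slitPlane_ne_zero (hslit t ht))
  refine ⟨?_, hne, fun t => Complex.arg c + d * t + Complex.arg (ρ t), ?_, ?_, ?_⟩
  · simp only [hf]
    exact ContinuousOn.mul (by fun_prop) hρc
  · refine ContinuousOn.add (by fun_prop) fun t ht => ?_
    exact (Complex.continuousAt_arg (hslit t ht)).comp_continuousWithinAt (hρc t ht)
  · intro t ht
    have hn : ‖f (γ t)‖ = ‖c‖ * ‖ρ t‖ := by
      rw [hf, norm_mul, norm_mul, Complex.norm_exp_ofReal_mul_I, mul_one]
    rw [hn, hf]
    conv_lhs => rw [← Complex.norm_mul_exp_arg_mul_I c, ← Complex.norm_mul_exp_arg_mul_I (ρ t)]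
    push_cast
    rw [add_mul, add_mul, Complex.exp_add, Complex.exp_add]
    ring
  · have hpi := Real.pi_pos
    beta_reduce
    rw [hper]
    field_simp
    linear_combination (-d : ℝ) * hab

/-- The orientation sign of the real linear map `w ↦ A w - conj w`. -/
noncomputable def orientation (A : ℂ) : ℤ := if 1 < ‖A‖ then 1 else -1

/-- At a regular zero the linear part `A w - conj w` dominates, so that the index is the sign of
its determinant `|A|² - 1`. -/
theorem hasPoincareIndex_of_regular {S : RatFunc ℂ} {ζ : ℂ} (h : IsRegularZero S ζ) :
    HasPoincareIndex (harm S) ζ (orientation (deriv (ratVal S) ζ)) := by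
  obtain ⟨⟨hp, h0⟩, hreg⟩ := h
  refine ⟨Or.inl h0, ?_⟩
  set A := deriv (ratVal S) ζ with hA
  have hd : HasDerivAt (ratVal S) A ζ := (analyticAt_ratVal hp).differentiableAt.hasDerivAt
  -- half of the least value of `|A w - conj w|` on the unit circle
  set κ := |‖A‖ - 1| / 2 with hκ
  have hκ0 : 0 < κ := half_pos (abs_pos.2 (sub_ne_zero.2 hreg))
  have hlit := hd.isLittleO.def hκ0
  obtain ⟨ρ, hρ, hball⟩ := Metric.eventually_nhds_iff.1
    (hlit.and ((isOpen_setOf_not_isPole S).mem_nhds hp))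
  have hval : ratVal S ζ = conj ζ := sub_eq_zero.1 h0
  -- the remainder of `harm S` after its linear part
  set E : ℂ → ℂ := fun z => ratVal S z - ratVal S ζ - A * (z - ζ) with hE
  have hharm : ∀ z, harm S z = A * (z - ζ) - conj (z - ζ) + E z := by
    intro z
    simp only [hE, harm, hval, map_sub]; ring
  have hEb : ∀ z ∈ ball ζ ρ, ‖E z‖ ≤ κ * ‖z - ζ‖ := by
    intro z hz
    have := (hball hz).1
    rw [smul_eq_mul, mul_comm _ A] at this
    exact this
  have hcont : ContinuousOn (ratVal S) (ball ζ ρ) := fun z hz =>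
    (analyticAt_ratVal (hball hz).2).continuousAt.continuousWithinAt
  have hhc : ContinuousOn (harm S) (ball ζ ρ) :=
    hcont.sub Complex.continuous_conj.continuousOn
  have hEc : ContinuousOn E (ball ζ ρ) :=
    (hcont.sub continuousOn_const).sub (by fun_prop)
  refine ⟨ρ, hρ, hhc.mono Set.sdiff_subset, ?_, ?_⟩
  · rintro z ⟨hz, hne⟩ hzero
    have hs : 0 < ‖z - ζ‖ := norm_pos_iff.2 (sub_ne_zero.2 hne)
    have h1 : E z = conj (z - ζ) - A * (z - ζ) := by
      have := hharm z
      rw [hzero] at this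
      linear_combination -this
    have h2 := hEb z hz
    rw [h1] at h2
    have h3 := abs_norm_sub_norm_le (conj (z - ζ)) (A * (z - ζ))
    rw [Complex.norm_conj, norm_mul] at h3
    have h4 : |‖z - ζ‖ - ‖A‖ * ‖z - ζ‖| = 2 * κ * ‖z - ζ‖ := by
      rw [hκ, show ‖z - ζ‖ - ‖A‖ * ‖z - ζ‖ = -((‖A‖ - 1) * ‖z - ζ‖) by ring, abs_neg, abs_mul,
        abs_of_pos hs]
      ring
    rw [h4] at h3
    nlinarith
  intro s hs hsρ
  have hmem : ∀ t, circleMap ζ s t ∈ ball ζ ρ := fun t => by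
    rw [mem_ball, dist_eq_norm, circleMap_sub_center, norm_circleMap_zero, abs_of_pos hs]
    exact hsρ
  have hEcirc : Continuous fun t => E (circleMap ζ s t) :=
    hEc.comp_continuous (continuous_circleMap ζ s) hmem
  have hEcb : ∀ t, ‖E (circleMap ζ s t)‖ ≤ κ * s := fun t => by
    have := hEb _ (hmem t)
    rwa [circleMap_sub_center, norm_circleMap_zero, abs_of_pos hs] at this
  have hEper : E (circleMap ζ s 0) = E (circleMap ζ s (2 * Real.pi)) := by
    congr 1
    simp [circleMap, Complex.exp_two_pi_mul_I]
  have hs0 : (s : ℂ) ≠ 0 := by exact_mod_cast hs.ne'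
  have hexpn : ∀ t : ℝ, ‖Complex.exp (-(t * Complex.I))‖ = 1 := fun t => by
    rw [← neg_mul, ← Complex.ofReal_neg, Complex.norm_exp_ofReal_mul_I]
  have hexpp : ∀ t : ℝ, ‖Complex.exp (t * Complex.I)‖ = 1 := Complex.norm_exp_ofReal_mul_I
  have hcm : ∀ t, harm S (circleMap ζ s t) = A * (s * Complex.exp (t * Complex.I)) -
      s * Complex.exp (-(t * Complex.I)) + E (circleMap ζ s t) := by
    intro t
    rw [hharm, circleMap_sub_center]
    simp only [circleMap, zero_add, map_mul, Complex.conj_ofReal, ← Complex.exp_conj,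
      Complex.conj_I, mul_neg]
  have hc1 : Continuous fun t : ℝ => Complex.exp (-(t * Complex.I)) := by fun_prop
  have hc2 : Continuous fun t : ℝ => Complex.exp (t * Complex.I) := by fun_prop
  have hee : ∀ t : ℝ, Complex.exp (t * Complex.I) * Complex.exp (-(t * Complex.I)) = 1 :=
    fun t => by rw [← Complex.exp_add, add_neg_cancel, Complex.exp_zero]
  have hepi : Complex.exp (-((2 * Real.pi : ℝ) * Complex.I)) = 1 := by
    rw [Complex.exp_neg]; push_cast; rw [Complex.exp_two_pi_mul_I, inv_one]
  have hepi' : Complex.exp ((2 * Real.pi : ℝ) * Complex.I) = 1 := by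
    push_cast; rw [Complex.exp_two_pi_mul_I]
  unfold orientation
  split_ifs with hgt
  · have hA0 : A ≠ 0 := by
      rintro h; rw [h, norm_zero] at hgt; linarith
    have hκ' : κ = (‖A‖ - 1) / 2 := by rw [hκ, abs_of_pos (by linarith)]
    refine hasWinding_of_polar (c := A * s)
      (ρ := fun t => 1 + Complex.exp (-(t * Complex.I)) *
        (E (circleMap ζ s t) / s - Complex.exp (-(t * Complex.I))) / A)
      (mul_ne_zero hA0 hs0)
      (continuous_const.add
        ((hc1.mul ((hEcirc.div_const _).sub hc1)).div_const _)).continuousOn ?_ ?_ (by ring) ?_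
    · intro t _
      rw [add_sub_cancel_left, norm_div, norm_mul, hexpn, one_mul,
        div_lt_one (norm_pos_iff.2 hA0)]
      calc _ ≤ ‖E (circleMap ζ s t) / s‖ + ‖Complex.exp (-(t * Complex.I))‖ := norm_sub_le _ _
        _ ≤ κ + 1 := by
          rw [hexpn, norm_div, Complex.norm_real, Real.norm_of_nonneg hs.le]
          gcongr
          rw [div_le_iff₀ hs]; exact hEcb t
        _ < ‖A‖ := by linarith
    · simp only [hepi, ← hEper]; simp
    · intro t
      rw [hcm]
      push_cast
      rw [one_mul]
      field_simp
      linear_combination (-E (circleMap ζ s t) + s * Complex.exp (-(t * Complex.I))) * hee t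
  · have hlt : ‖A‖ < 1 := lt_of_le_of_ne (not_lt.1 hgt) hreg
    have hκ' : κ = (1 - ‖A‖) / 2 := by rw [hκ, abs_of_neg (by linarith)]; ring
    refine hasWinding_of_polar (c := -s)
      (ρ := fun t => 1 - Complex.exp (t * Complex.I) *
        (A * Complex.exp (t * Complex.I) + E (circleMap ζ s t) / s))
      (neg_ne_zero.2 hs0)
      (continuous_const.sub
        (hc2.mul ((continuous_const.mul hc2).add (hEcirc.div_const _)))).continuousOn ?_ ?_ (by ring) ?_
    · intro t _
      rw [sub_sub_cancel_left, norm_neg, norm_mul, hexpp, one_mul]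
      calc _ ≤ ‖A * Complex.exp (t * Complex.I)‖ + ‖E (circleMap ζ s t) / s‖ := norm_add_le _ _
        _ ≤ ‖A‖ + κ := by
          rw [norm_mul, hexpp, mul_one, norm_div, Complex.norm_real, Real.norm_of_nonneg hs.le]
          gcongr
          rw [div_le_iff₀ hs]; exact hEcb t
        _ < 1 := by linarith
    · simp only [hepi', ← hEper]; simp
    · intro t
      rw [hcm]
      push_cast
      rw [neg_one_mul, neg_mul]
      field_simp
      linear_combination (-E (circleMap ζ s t) - s * A * Complex.exp (t * Complex.I)) * hee t

/-! ### Zeros of the perturbation near a regular zero -/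

/-- The real linear map `w ↦ A w - conj w`, invertible for `|A| ≠ 1`. -/
noncomputable def harmLinear (A : ℂ) : ℂ →L[ℝ] ℂ :=
  A • ContinuousLinearMap.id ℝ ℂ - (Complex.conjCLE : ℂ →L[ℝ] ℂ)

theorem harmLinear_apply (A w : ℂ) : harmLinear A w = A * w - conj w := by
  simp [harmLinear]

theorem exists_harmLinear_equiv {A : ℂ} (hA : ‖A‖ ≠ 1) :
    ∃ L : ℂ ≃L[ℝ] ℂ, (L : ℂ →L[ℝ] ℂ) = harmLinear A := by
  have hinj : Function.Injective (harmLinear A : ℂ →ₗ[ℝ] ℂ) := by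
    rw [← LinearMap.ker_eq_bot, LinearMap.ker_eq_bot']
    intro w hw
    have h1 : A * w = conj w := sub_eq_zero.1 ((harmLinear_apply A w).symm.trans hw)
    have h2 := congrArg norm h1
    rw [norm_mul, Complex.norm_conj] at h2
    by_contra hw0
    exact hA (mul_right_cancel₀ (norm_ne_zero_iff.2 hw0) (h2.trans (one_mul _).symm))
  refine ⟨(LinearEquiv.ofInjectiveEndo _ hinj).toContinuousLinearEquiv, ?_⟩
  ext w; rfl

/-- Near a regular zero `a ≠ z₀` of `f` the function `F` is close in `C¹` to an invertible real
linear map, so that it has exactly one zero in a small disk around `a`, of the same orientation. -/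
theorem eventually_zero_near_regular {R : RatFunc ℂ} {z₀ a : ℂ} (ha : IsRegularZero R a)
    (hne : a ≠ z₀) :
    ∀ᶠ r in 𝓝[>] (0 : ℝ), ∀ᶠ ε in 𝓝[>] (0 : ℝ),
      ∃ ζ ∈ ball a r, IsZero (perturb R z₀ ε) ζ ∧
        (∀ z ∈ ball a r, IsZero (perturb R z₀ ε) z → z = ζ) ∧
        ∃ m : ℤ, HasPoincareIndex (harm R) a m ∧
          HasPoincareIndex (harm (perturb R z₀ ε)) ζ m := by
  obtain ⟨⟨hp, h0⟩, hreg⟩ := ha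
  set A := deriv (ratVal R) a with hA
  obtain ⟨L, hL⟩ := exists_harmLinear_equiv hreg
  set N : NNReal := ‖(L.symm : ℂ →L[ℝ] ℂ)‖₊ with hN
  have hN0 : 0 < N := L.nnnorm_symm_pos
  have hgap : 0 < |‖A‖ - 1| := abs_pos.2 (sub_ne_zero.2 hreg)
  -- the first bound on `c` makes the approximation by `L` injective and open, the second keeps
  -- the modulus of the derivative on the same side of `1`
  obtain ⟨c, hc0, hcN, hcg⟩ : ∃ c : NNReal, 0 < c ∧ c < N⁻¹ ∧ (c : ℝ) < |‖A‖ - 1| := by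
    have hq : 0 < min N⁻¹ ⟨|‖A‖ - 1|, hgap.le⟩ := lt_min (inv_pos.2 hN0) hgap
    obtain ⟨c, hc0, hc⟩ := exists_between hq
    exact ⟨c, hc0, hc.trans_le (min_le_left _ _), hc.trans_le (min_le_right _ _)⟩
  have hc0' : (0 : ℝ) < c := hc0
  set d := dist a z₀ / 2 with hd
  have hd0 : 0 < d := half_pos (dist_pos.2 hne)
  have hRa := analyticAt_ratVal hp
  have hev : ∀ᶠ z in 𝓝 a, ¬ IsPole R z ∧ ‖deriv (ratVal R) z - A‖ < c / 2 ∧ d < dist z z₀ := by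
    refine ((isOpen_setOf_not_isPole R).eventually_mem hp).and (Filter.Eventually.and ?_ ?_)
    · have hcont : ContinuousAt (fun z => ‖deriv (ratVal R) z - A‖) a :=
        (hRa.deriv.continuousAt.sub continuousAt_const).norm
      exact hcont.eventually_lt continuousAt_const (by simpa [hA] using hc0)
    · exact continuousAt_const.eventually_lt
        (continuousAt_id.dist continuousAt_const) (half_lt_self (dist_pos.2 hne))
  obtain ⟨r₁, hr₁, hball⟩ := Metric.nhds_basis_closedBall.eventually_iff.1 hev
  filter_upwards [Ioo_mem_nhdsGT hr₁] with r hr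
  have hsub : closedBall a r ⊆ closedBall a r₁ := closedBall_subset_closedBall hr.2.le
  have hε1 : ∀ᶠ ε in 𝓝[>] (0 : ℝ), ε / d ^ 2 < c / 2 := by
    have hcont : ContinuousAt (fun ε : ℝ => ε / d ^ 2) 0 := by fun_prop
    exact (hcont.eventually_lt continuousAt_const (by simpa using hc0)).filter_mono
      nhdsWithin_le_nhds
  have hcN' : 0 < (N : ℝ)⁻¹ - c := by
    have : (c : ℝ) < (N⁻¹ : NNReal) := hcN
    rw [NNReal.coe_inv] at this
    linarith
  have hε2 : ∀ᶠ ε in 𝓝[>] (0 : ℝ), ε / ‖a - z₀‖ < ((N : ℝ)⁻¹ - c) * (r / 2) := by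
    have hcont : ContinuousAt (fun ε : ℝ => ε / ‖a - z₀‖) 0 := by fun_prop
    have hr0 := hr.1
    exact (hcont.eventually_lt continuousAt_const (by rw [zero_div]; positivity)).filter_mono
      nhdsWithin_le_nhds
  filter_upwards [hε1, hε2, self_mem_nhdsWithin] with ε h1 h2 hε
  have hε : 0 < ε := hε
  have hz0 : ∀ z ∈ closedBall a r, z ≠ z₀ := by
    rintro z hz rfl
    have := (hball (hsub hz)).2.2
    rw [dist_self] at this
    linarith
  have hder : ∀ z ∈ closedBall a r, HasDerivAt (ratVal (perturb R z₀ ε))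
      (deriv (ratVal R) z - ε / (z - z₀) ^ 2) z := fun z hz =>
    hasDerivAt_ratVal_perturb ε (hz0 z hz) (hball (hsub hz)).1
  have hbound : ∀ z ∈ closedBall a r, ‖deriv (ratVal R) z - ε / (z - z₀) ^ 2 - A‖ ≤ c := by
    intro z hz
    obtain ⟨_, h4, h5⟩ := hball (hsub hz)
    have h6 : ‖(ε : ℂ) / (z - z₀) ^ 2‖ ≤ ε / d ^ 2 := by
      rw [norm_div, norm_pow, Complex.norm_real, Real.norm_of_nonneg hε.le, ← dist_eq_norm]
      gcongr
    calc _ = ‖(deriv (ratVal R) z - A) - ε / (z - z₀) ^ 2‖ := by congr 1; ring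
      _ ≤ ‖deriv (ratVal R) z - A‖ + ‖(ε : ℂ) / (z - z₀) ^ 2‖ := norm_sub_le _ _
      _ ≤ c := by linarith
  have happrox : ApproximatesLinearOn (harm (perturb R z₀ ε)) (L : ℂ →L[ℝ] ℂ)
      (closedBall a r) c := by
    intro x hx y hy
    have := (convex_closedBall a r).norm_image_sub_le_of_norm_hasDerivWithin_le
      (f := fun z => ratVal (perturb R z₀ ε) z - A * z)
      (fun z hz => ((hder z hz).sub ((hasDerivAt_id z).const_mul A)).hasDerivWithinAt)
      (C := c) (fun z hz => by simpa using hbound z hz) hy hx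
    refine le_trans (le_of_eq ?_) this
    congr 1
    rw [hL, harmLinear_apply]
    simp only [harm, map_sub]
    ring
  have hinj := happrox.injOn (Or.inr hcN)
  have hpole : ∀ z ∈ closedBall a r, ¬ IsPole (perturb R z₀ ε) z := fun z hz =>
    (isPole_perturb_iff ε (hz0 z hz)).not.2 (hball (hsub hz)).1
  have hamem : a ∈ closedBall a r := mem_closedBall_self hr.1.le
  have hFa : harm (perturb R z₀ ε) a = ε / (a - z₀) := by
    rw [harm, ratVal_perturb ε hne hp]
    rw [harm] at h0
    linear_combination h0
  obtain ⟨ζ, hζ, hζ0⟩ := happrox.surjOn_closedBall_of_nonlinearRightInverse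
    L.toNonlinearRightInverse (ε := r / 2) (b := a) (by linarith [hr.1])
    (closedBall_subset_closedBall (by linarith [hr.1])) (show (0 : ℂ) ∈ _ by
      rw [mem_closedBall, dist_comm, dist_zero_right, hFa, norm_div, Complex.norm_real,
        Real.norm_of_nonneg hε.le]
      exact h2.le)
  have hζb : ζ ∈ ball a r := closedBall_subset_ball (by linarith [hr.1]) hζ
  have hζc := ball_subset_closedBall hζb
  have hζreg : orientation (deriv (ratVal (perturb R z₀ ε)) ζ) = orientation A ∧
      ‖deriv (ratVal (perturb R z₀ ε)) ζ‖ ≠ 1 := by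
    have h3 := hbound ζ hζc
    rw [← (hder ζ hζc).deriv] at h3
    have h4 := abs_le.1 ((abs_norm_sub_norm_le _ _).trans h3)
    unfold orientation
    rcases lt_or_gt_of_ne hreg with h | h
    · rw [abs_of_neg (by linarith)] at hcg
      rw [if_neg (by linarith [h4.2]), if_neg (by linarith)]
      exact ⟨rfl, by linarith [h4.2]⟩
    · rw [abs_of_pos (by linarith)] at hcg
      rw [if_pos (by linarith [h4.1]), if_pos h]
      exact ⟨rfl, by linarith [h4.1]⟩
  refine ⟨ζ, hζb, ⟨hpole ζ hζc, hζ0⟩, fun z hz hz0 =>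
    hinj (ball_subset_closedBall hz) hζc (hz0.2.trans hζ0.symm), orientation A,
    hasPoincareIndex_of_regular ⟨⟨hp, h0⟩, hreg⟩, ?_⟩
  rw [← hζreg.1]
  exact hasPoincareIndex_of_regular ⟨⟨hpole ζ hζc, hζ0⟩, hζreg.2⟩

/-! ### A lower bound off the zeros -/

/-- `f` is bounded away from `0` off any neighbourhood of its zeros. Near infinity this is the
hypothesis on `f`; elsewhere it holds as `p - conj z * q` has no zeros other than those of `f`. -/
theorem exists_lower_bound {R : RatFunc ℂ}
    (hlim : Tendsto (fun z => ‖harm R z‖) (Bornology.cobounded ℂ) atTop)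
    {U : Set ℂ} (hU : IsOpen U) (hZ : ∀ z, IsZero R z → z ∈ U) :
    ∃ μ : ℝ, 0 < μ ∧ ∀ z, z ∉ U → ¬ IsPole R z → μ ≤ ‖harm R z‖ := by
  obtain ⟨M, -, hM⟩ := (hasBasis_cobounded_norm (E := ℂ)).eventually_iff.1
    (hlim.eventually_ge_atTop 1)
  set K : Set ℂ := closedBall 0 M \ U with hK
  have hKc : IsCompact K := (isCompact_closedBall 0 M).diff hU
  have hpc : Continuous fun z => ‖R.num.eval z - conj z * R.denom.eval z‖ := by
    have h1 := R.num.continuous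
    have h2 := R.denom.continuous
    have h3 := Complex.continuous_conj
    fun_prop
  have hpos : ∀ z ∈ K, 0 < ‖R.num.eval z - conj z * R.denom.eval z‖ := by
    intro z hz
    rw [norm_pos_iff]
    intro h
    by_cases hp : IsPole R z
    · have hp' : R.denom.eval z = 0 := hp
      obtain ⟨u, v, huv⟩ := RatFunc.isCoprime_num_denom R
      have := congrArg (Polynomial.eval z) huv
      rw [hp', mul_zero, sub_zero] at h
      simp [h, hp'] at this
    · refine hz.2 (hZ z ⟨hp, ?_⟩)
      have hp' : R.denom.eval z ≠ 0 := hp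
      rw [harm, ratVal_eq_div, sub_eq_zero, div_eq_iff hp']
      exact sub_eq_zero.1 h
  obtain ⟨μ₁, hμ₁, hμ⟩ : ∃ μ₁ : ℝ, 0 < μ₁ ∧
      ∀ z ∈ K, μ₁ ≤ ‖R.num.eval z - conj z * R.denom.eval z‖ := by
    rcases K.eq_empty_or_nonempty with h | h
    · exact ⟨1, one_pos, by simp [h]⟩
    · obtain ⟨x, hx, hmin⟩ := hKc.exists_isMinOn h hpc.continuousOn
      exact ⟨_, hpos x hx, fun z hz => hmin hz⟩
  obtain ⟨B, hB⟩ := hKc.exists_bound_of_continuousOn R.denom.continuous.continuousOn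
  have hB1 : 0 < max B 1 := lt_max_of_lt_right one_pos
  refine ⟨min 1 (μ₁ / max B 1), lt_min one_pos (div_pos hμ₁ hB1), fun z hzU hp => ?_⟩
  by_cases hz : z ∈ closedBall 0 M
  · refine (min_le_right _ _).trans ?_
    have hp' : R.denom.eval z ≠ 0 := hp
    have h1 : R.num.eval z - conj z * R.denom.eval z = harm R z * R.denom.eval z := by
      rw [harm, ratVal_eq_div]; field_simp
    have h2 := hμ z ⟨hz, hzU⟩
    rw [h1, norm_mul] at h2
    rw [div_le_iff₀ hB1]
    refine h2.trans ?_
    gcongr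
    exact (hB z ⟨hz, hzU⟩).trans (le_max_left _ _)
  · refine (min_le_left _ _).trans (hM ?_)
    rw [mem_closedBall_zero_iff, not_le] at hz
    exact hz.le

end RationalHarmonic

/-! ### The zeros of `F` -/

open RationalHarmonic Filter Topology Metric

theorem mainTheorem1 (R : RatFunc ℂ) (hdeg : 2 ≤ RationalHarmonic.ratDegree R)
    (hlim : Filter.Tendsto (fun z => ‖RationalHarmonic.harm R z‖)
      (Bornology.cobounded ℂ) Filter.atTop)
    (z₀ : ℂ) (n : ℕ) (hn : 3 ≤ n)
    (hz₀ : RationalHarmonic.IsZero R z₀)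
    (hvanish : ∀ k : ℕ, 1 ≤ k → k ≤ n - 2 →
      iteratedDeriv k (RationalHarmonic.ratVal R) z₀ = 0)
    (hnonzero : iteratedDeriv (n - 1) (RationalHarmonic.ratVal R) z₀ ≠ 0)
    (η : ℝ) (hη : η = Real.sqrt ((n : ℝ) / ((n : ℝ) - 1))) :
    ∃ r : ℝ, 0 < r ∧ ∃ ε₀ : ℝ, 0 < ε₀ ∧ ∀ ε : ℝ, 0 < ε → ε < ε₀ →
      -- the closed disk of radius `η √ε` contains no zero of `f` except `z₀`
      (∀ z ∈ Metric.closedBall z₀ (η * Real.sqrt ε), RationalHarmonic.IsZero R z → z = z₀) ∧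
      -- (i)
      ((n : ℕ∞) ≤ Set.encard {z | z ∈ RationalHarmonic.annulus z₀ (η⁻¹ * Real.sqrt ε) (Real.sqrt ε) ∧
          RationalHarmonic.IsZero (RationalHarmonic.perturb R z₀ ε) z} ∧
        (n : ℕ∞) ≤ Set.encard {z | z ∈ RationalHarmonic.annulus z₀ (Real.sqrt ε) (η * Real.sqrt ε) ∧
          RationalHarmonic.IsZero (RationalHarmonic.perturb R z₀ ε) z} ∧
        (∀ z ∈ Metric.closedBall z₀ (η⁻¹ * Real.sqrt ε),
          ¬ RationalHarmonic.IsZero (RationalHarmonic.perturb R z₀ ε) z) ∧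
        (RationalHarmonic.IsRegular (RationalHarmonic.perturb R z₀ ε) →
          (n : ℕ∞) ≤ Set.encard
            {z | z ∈ RationalHarmonic.annulus z₀ (η⁻¹ * Real.sqrt ε) (Real.sqrt ε) ∧
              RationalHarmonic.IsSensePreservingZero (RationalHarmonic.perturb R z₀ ε) z} ∧
          (n : ℕ∞) ≤ Set.encard
            {z | z ∈ RationalHarmonic.annulus z₀ (Real.sqrt ε) (η * Real.sqrt ε) ∧
              RationalHarmonic.IsSenseReversingZero (RationalHarmonic.perturb R z₀ ε) z})) ∧
      -- (ii)
      ((∀ a b : ℂ, RationalHarmonic.IsRegularZero R a → η * Real.sqrt ε < dist a z₀ →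
          RationalHarmonic.IsRegularZero R b → η * Real.sqrt ε < dist b z₀ → a ≠ b →
          Disjoint (Metric.closedBall a r) (Metric.closedBall b r)) ∧
        (∀ a : ℂ, RationalHarmonic.IsRegularZero R a → η * Real.sqrt ε < dist a z₀ →
          ∃ ζ ∈ Metric.ball a r, RationalHarmonic.IsZero (RationalHarmonic.perturb R z₀ ε) ζ ∧
            (∀ z ∈ Metric.ball a r,
              RationalHarmonic.IsZero (RationalHarmonic.perturb R z₀ ε) z → z = ζ) ∧
            ∃ m : ℤ, RationalHarmonic.HasPoincareIndex (RationalHarmonic.harm R) a m ∧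
              RationalHarmonic.HasPoincareIndex
                (RationalHarmonic.harm (RationalHarmonic.perturb R z₀ ε)) ζ m)) ∧
      -- (iii)
      (RationalHarmonic.IsRegular R →
        ∃ N : ℕ,
          Set.encard {z | η * Real.sqrt ε < dist z z₀ ∧ RationalHarmonic.IsZero R z} = (N : ℕ∞) ∧
          Set.encard {z | η * Real.sqrt ε < dist z z₀ ∧
            RationalHarmonic.IsZero (RationalHarmonic.perturb R z₀ ε) z} = (N : ℕ∞)) := by
  obtain ⟨m, rfl⟩ : ∃ m, n = m + 3 := ⟨n - 3, by omega⟩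
  have hη' : η = Real.sqrt ((m + 3 : ℝ) / (m + 2)) := by
    rw [hη]; congr 2 <;> push_cast <;> ring
  have hη0 : 0 < η := by rw [hη']; positivity
  obtain ⟨ρ, hρ, hRρ, hcenter⟩ := exists_near_center hz₀ hvanish hnonzero hη'
  set Zr : Set ℂ := {a | IsZero R a ∧ a ≠ z₀} with hZr
  have hZfin : Zr.Finite := (finite_setOf_isZero hdeg).subset fun a ha => ha.1
  have hZρ : ∀ a ∈ Zr, ρ ≤ dist a z₀ := fun a ha => by
    rw [dist_eq_norm]
    exact not_lt.1 fun h => ha.2 (hRρ a h ha.1)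
  have hZreg : {a | IsRegularZero R a ∧ a ≠ z₀}.Finite :=
    hZfin.subset fun a ha => ⟨ha.1.1, ha.2⟩
  have h1 : ∀ᶠ r in 𝓝[>] (0 : ℝ), ∀ a ∈ {a | IsRegularZero R a ∧ a ≠ z₀}, _ :=
    (eventually_all_finite hZreg).2 fun a ha =>
      eventually_zero_near_regular (z₀ := z₀) ha.1 ha.2
  have h2 : ∀ᶠ r in 𝓝[>] (0 : ℝ), ∀ a ∈ Zr, ∀ b ∈ Zr, a ≠ b →
      Disjoint (closedBall a r) (closedBall b r) := by
    refine (eventually_all_finite hZfin).2 fun a _ => (eventually_all_finite hZfin).2 fun b _ => ?_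
    by_cases hab : a = b
    · exact Eventually.of_forall fun r h => absurd hab h
    · filter_upwards [Ioo_mem_nhdsGT (half_pos (dist_pos.2 hab))] with r hr _
      exact closedBall_disjoint_closedBall (by linarith [hr.2])
  obtain ⟨r, hr1, hr2, hr0, hrρ⟩ :=
    (h1.and (h2.and (Ioo_mem_nhdsGT (half_pos hρ)))).exists
  -- off this set `f` is bounded below; inside it the zeros of `F` are already known
  have hU : IsOpen (ball z₀ ρ ∪ ⋃ a ∈ Zr, ball a r) :=
    isOpen_ball.union (isOpen_biUnion fun _ _ => isOpen_ball)
  obtain ⟨μ, hμ, hlow⟩ := exists_lower_bound hlim hU (fun z hz => by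
    by_cases h : z = z₀
    · exact Or.inl (h ▸ mem_ball_self hρ)
    · exact Or.inr (Set.mem_biUnion (show z ∈ Zr from ⟨hz, h⟩) (mem_ball_self hr0)))
  have hε1 : ∀ᶠ ε in 𝓝[>] (0 : ℝ), η * Real.sqrt ε < ρ / 2 := by
    have hc : ContinuousAt (fun ε => η * Real.sqrt ε) 0 := by fun_prop
    exact (hc.eventually_lt continuousAt_const (by simpa using hρ)).filter_mono nhdsWithin_le_nhds
  have hε2 : ∀ᶠ ε in 𝓝[>] (0 : ℝ), ε / ρ < μ := by
    have hc : ContinuousAt (fun ε : ℝ => ε / ρ) 0 := by fun_prop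
    exact (hc.eventually_lt continuousAt_const (by simpa using hμ)).filter_mono nhdsWithin_le_nhds
  have hall := hcenter.and (((eventually_all_finite hZreg).2 hr1).and (hε1.and hε2))
  obtain ⟨ε₀, hε₀, hsub⟩ := mem_nhdsGT_iff_exists_Ioo_subset.1 hall
  refine ⟨r, hr0, ε₀, hε₀, fun ε hε hεε₀ => ?_⟩
  obtain ⟨⟨c1, c2, c3, c4⟩, hreg, c5, c6⟩ := hsub ⟨hε, hεε₀⟩
  have hs0 : 0 < Real.sqrt ε := Real.sqrt_pos.2 hε
  have hηs : 0 < η * Real.sqrt ε := mul_pos hη0 hs0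
  have hη1 : 1 ≤ η := by
    rw [hη', Real.one_le_sqrt, one_le_div (by positivity)]
    linarith
  have hle : η⁻¹ * Real.sqrt ε ≤ η * Real.sqrt ε := by
    gcongr
    exact (inv_le_one_of_one_le₀ hη1).trans hη1
  have hne : ∀ a, η * Real.sqrt ε < dist a z₀ → a ≠ z₀ := by
    rintro a ha rfl
    rw [dist_self] at ha
    exact lt_asymm ha hηs
  refine ⟨fun z hz hzero => hRρ z ?_ hzero, ⟨?_, ?_, fun z hz hF => ?_, fun _ => ⟨c3, c4⟩⟩,
    ⟨fun a b ha had hb hbd hab => ?_, fun a ha had => ?_⟩, fun hregular => ?_⟩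
  · rw [← dist_eq_norm]; exact (mem_closedBall.1 hz).trans_lt c1
  · exact c3.trans (Set.encard_le_encard fun z hz => ⟨hz.1, hz.2.1⟩)
  · exact c4.trans (Set.encard_le_encard fun z hz => ⟨hz.1, hz.2.1⟩)
  · rw [mem_closedBall, dist_eq_norm] at hz
    exact absurd (c2 z (hz.trans_lt (hle.trans_lt c1)) hF).1 (not_lt.2 hz)
  · exact hr2 a ⟨ha.1, hne a had⟩ b ⟨hb.1, hne b hbd⟩ hab
  · exact hreg a ⟨ha, hne a had⟩
  -- for regular `f` the map `ζ`, from a zero of `f` to the nearby zero of `F`, is a bijection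
  have hreg' : ∀ a ∈ Zr, _ := fun a ha => hreg a ⟨hregular a ha.1, ha.2⟩
  choose! ζ hζb hζ0 hζu _ using hreg'
  have hfar : ∀ a ∈ Zr, η * Real.sqrt ε < dist (ζ a) z₀ := by
    intro a ha
    have h3 := mem_ball'.1 (hζb a ha)
    have h4 := hZρ a ha
    have h5 := dist_triangle a (ζ a) z₀
    linarith
  have hset : {z | η * Real.sqrt ε < dist z z₀ ∧ IsZero R z} = Zr := by
    ext z
    refine ⟨fun hz => ⟨hz.2, hne z hz.1⟩, fun hz => ⟨?_, hz.1⟩⟩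
    exact c1.trans_le (hZρ z hz)
  have hsetF : {z | η * Real.sqrt ε < dist z z₀ ∧ IsZero (perturb R z₀ ε) z} = ζ '' Zr := by
    ext z
    constructor
    · rintro ⟨hz, hF⟩
      have hzρ : ρ ≤ dist z z₀ := by
        rw [dist_eq_norm] at hz ⊢
        exact not_lt.1 fun h => lt_asymm hz (c2 z h hF).2
      obtain ⟨hzne, hpole, -⟩ := (isZero_perturb_iff hε.ne' hz₀.1).1 hF
      have hzU : z ∈ ball z₀ ρ ∪ ⋃ a ∈ Zr, ball a r := by
        by_contra hzU
        have h3 := hlow z hzU hpole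
        have h4 : harm R z = -(ε / (z - z₀)) := by
          have := hF.2
          rw [harm, ratVal_perturb ε hzne hpole] at this
          rw [harm]
          linear_combination this
        rw [h4, norm_neg, norm_div, Complex.norm_real, Real.norm_of_nonneg hε.le,
          ← dist_eq_norm] at h3
        have h5 : ε / dist z z₀ ≤ ε / ρ := by gcongr
        linarith
      rcases hzU with h | h
      · exact absurd (mem_ball.1 h) (not_lt.2 hzρ)
      · obtain ⟨a, ha, hza⟩ := Set.mem_iUnion₂.1 h
        exact ⟨a, ha, (hζu a ha z hza hF).symm⟩
    · rintro ⟨a, ha, rfl⟩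
      exact ⟨hfar a ha, hζ0 a ha⟩
  have hinj : Set.InjOn ζ Zr := by
    intro a ha b hb hab
    by_contra h
    exact Set.disjoint_left.1 (hr2 a ha b hb h) (ball_subset_closedBall (hζb a ha))
      (hab ▸ ball_subset_closedBall (hζb b hb))
  refine ⟨Zr.ncard, ?_, ?_⟩
  · rw [hset, hZfin.cast_ncard_eq]
  · rw [hsetF, hinj.encard_image, hZfin.cast_ncard_eq]
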